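/- Let $n\ge1$ and let $Q$ be an $n\times n$ GOE matrix: $Q$ is symmetric, its entries $Q_{ij}$, $i\le j$, are independent, $Q_{ii}\sim N(0,1)$, and $Q_{ij}\sim N(0,1/2)$ for $i<j$. Then the problem $$\min\{x^\top Qx:\ x\in\mathbb R^n,\ x_i\ge0\ \text{for all } i,\ \textstyle\sum_i x_i=1\}$$ almost surely has a unique global optimizer $x^\star$. Let $\kappa_n:=|\{i:x^\star_i>0\}|$ be the size of its support. The following hold. 1. For every fixed integer $k\ge3$, put $\sigma_k^2:=\frac{k+1}{2k^2}$ and $\alpha_k:=\sigma_k^{-2}$; then $\alpha_k=\frac{2k^2}{k+1}=2k-2+\frac2{k+1}$, and there is a constant $C_k<\infty$, depending only on $k$, such that for all $n\ge1$ $$\mathbb P(\kappa_n=k)\le C_k\,n^{2-k-2/(k+1)}(\log n)^{k-3/2+1/(k+1)}.$$ 2. There is a constant $C>0$ such that for all $n\ge1$ $$\mathbb P(\kappa_n=3)\le C\,\frac{(\log n)^{7/4}}{n^{3/2}}\qquad\text{and}\qquad \mathbb P(\kappa_n\ge3)\le C\,\frac{(\log n)^{7/4}}{n^{3/2}}.$$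 3. As $n\to\infty$, $\frac{(\log n)^{7/4}}{n^{3/2}}=o\!\left(\frac1{n(\log n)^{3/2}}\right)$, and consequently $$\mathbb P(\kappa_n\ge3)=o\!\left(\frac1{n(\log n)^{3/2}}\right).$$ -/

import Mathlib

open MeasureTheory ProbabilityTheory Filter Asymptotics
open scoped Matrix NNReal

noncomputable section

/-- Positions on or above the diagonal of an `n × n` matrix. -/
abbrev UpperIndex (n : ℕ) : Type := {p : Fin n × Fin n // p.1 ≤ p.2}

/-- The joint law of the upper-triangular entries of the GOE matrix: independent centred
Gaussians, with variance `1` on the diagonal and `1/2` off the diagonal. -/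
def goeMeasure (n : ℕ) : Measure (UpperIndex n → ℝ) :=
  Measure.pi fun p => gaussianReal 0 (if p.1.1 = p.1.2 then 1 else 1 / 2)

instance (n : ℕ) : IsProbabilityMeasure (goeMeasure n) := by
  unfold goeMeasure
  infer_instance

/-- The random GOE matrix `Q`: the symmetric matrix with the given upper-triangular entries,
regarded as a random variable on the probability space `goeMeasure n`. -/
def goeMatrix {n : ℕ} (w : UpperIndex n → ℝ) : Matrix (Fin n) (Fin n) ℝ :=
  Matrix.of fun i j => w ⟨(min i j, max i j), min_le_max⟩

/-- `x` is a global minimizer of `x ↦ xᵀ Q x` over the standard simplex. -/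
def IsGlobalOptimizer {n : ℕ} (Q : Matrix (Fin n) (Fin n) ℝ) (x : Fin n → ℝ) : Prop :=
  x ∈ stdSimplex ℝ (Fin n) ∧ IsMinOn (fun y => y ⬝ᵥ (Q *ᵥ y)) (stdSimplex ℝ (Fin n)) x

open Classical in
/-- The number `κ` of positive coordinates of the unique global optimizer of the standard
quadratic program of `Q`. The value is `0` when there is no unique global optimizer. -/
def kappa {n : ℕ} (Q : Matrix (Fin n) (Fin n) ℝ) : ℕ :=
  if h : ∃! x, IsGlobalOptimizer Q x then {i | 0 < h.choose i}.ncard else 0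

/-- `P(κ_n = k)`. -/
def probKappaEq (n k : ℕ) : ℝ := (goeMeasure n).real {w | kappa (goeMatrix w) = k}

/-- `P(κ_n ≥ k)`. -/
def probKappaGe (n k : ℕ) : ℝ := (goeMeasure n).real {w | k ≤ kappa (goeMatrix w)}

/-- `σ_k² = (k + 1) / (2 k²)`. -/
def sigmaSq (k : ℕ) : ℝ := ((k : ℝ) + 1) / (2 * (k : ℝ) ^ 2)

/-- `α_k = 1 / σ_k²`. -/
def alpha (k : ℕ) : ℝ := (sigmaSq k)⁻¹

end

/-! Uniqueness is an envelope argument. The optimal value is a minimum of linear functions of the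
entries, hence Lipschitz, hence differentiable almost everywhere by Rademacher. At such a point
every optimizer satisfies `x i ^ 2 = ∂V/∂Q_ii`, so the nonnegative vector `x` is determined by `V`.

For the support size, let `λ` be the optimal value and `S`, of size `k`, the support. Then `(Qx)_i ≤
λ` on `S`, and `λ ≤ Q_ll` for every `l`, as vertices are feasible. Averaging the first inequality
over `S` exhibits a `j ∈ S` whose column mean over `S` lies below the entire diagonal
(`IsGlobalOptimizer.exists_columnMean_le`). That mean is Gaussian of variance `sigmaSq k` and
independent of the `n - 1` diagonal entries other than `Q_jj`, so the event has probability at most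
`∫ (1 - Φ)^(n-1) dN(0, σ_k²)`. The density of `N(0, 1/α)` is a multiple of `φ^α`. Mills' bound `φ ≤
C|r|Φ` and the substitution `u = Φ(r)` turn the integral into a Gamma integral of order `n^(-α) (log
n)^((α-1)/2)` (`exists_lintegral_gaussianReal_Ici_pow_le`). A union bound over `(S, j)` costs `n^k`,
and `k - α_k` is the stated exponent.

The constants depend on `k`, so these bounds cannot simply be summed over `k ≥ 4`. There `α_k`
leaves enough room for a cruder argument: the diagonal minimum lies below `-√(9/5 log n)` up to a
negligible event, and a Chernoff bound for the column means is uniform in `k`. -/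

/-! ### Almost sure uniqueness of the optimizer -/

/-- A finite product of nondegenerate Gaussian measures is absolutely continuous with respect to
Lebesgue measure. -/
theorem pi_gaussianReal_absolutelyContinuous {ι : Type*} [Fintype ι] (m : ι → ℝ) (v : ι → ℝ≥0)
    (hv : ∀ i, v i ≠ 0) :
    Measure.pi (fun i => gaussianReal (m i) (v i)) ≪ (volume : Measure (ι → ℝ)) := by
  have hdens : Measure.pi (fun i => gaussianReal (m i) (v i)) =
      (volume : Measure (ι → ℝ)).withDensity
        (fun x => ENNReal.ofReal (∏ i, gaussianPDFReal (m i) (v i) (x i))) := by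
    -- It suffices to compare the measures on boxes, where the density factors over coordinates.
    refine (Measure.pi_eq fun s hs => ?_)
    rw [withDensity_apply _ (MeasurableSet.univ_pi hs)]
    rw [← ofReal_integral_eq_lintegral_ofReal]
    · rw [← integral_indicator (MeasurableSet.univ_pi hs)]
      have hprod : (fun x : ι → ℝ => (Set.univ.pi s).indicator
          (fun x => ∏ i, gaussianPDFReal (m i) (v i) (x i)) x) =
          fun x => ∏ i, (s i).indicator (gaussianPDFReal (m i) (v i)) (x i) := by
        funext x
        by_cases hx : x ∈ Set.univ.pi s
        · rw [Set.indicator_of_mem hx]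
          exact Finset.prod_congr rfl fun i _ => by
            rw [Set.indicator_of_mem (hx i (Set.mem_univ i))]
        · rw [Set.indicator_of_notMem hx]
          simp only [Set.mem_univ_pi, not_forall] at hx
          obtain ⟨i, hi⟩ := hx
          exact (Finset.prod_eq_zero (Finset.mem_univ i) (Set.indicator_of_notMem hi _)).symm
      rw [hprod, integral_fintype_prod_volume_eq_prod, ENNReal.ofReal_prod_of_nonneg]
      · refine Finset.prod_congr rfl fun i _ => ?_
        rw [integral_indicator (hs i), gaussianReal_apply_eq_integral _ (hv i)]
      · intro i _
        exact integral_nonneg fun x =>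
          Set.indicator_nonneg (fun y _ => gaussianPDFReal_nonneg _ _ y) x
    · exact (Integrable.fintype_prod fun i => integrable_gaussianPDFReal (m i) (v i)).integrableOn
    · exact ae_of_all _ fun x => Finset.prod_nonneg fun i _ => gaussianPDFReal_nonneg _ _ _
  rw [hdens]
  exact withDensity_absolutelyContinuous _ _

theorem goeMeasure_absolutelyContinuous (n : ℕ) :
    goeMeasure n ≪ (volume : Measure (UpperIndex n → ℝ)) := by
  refine pi_gaussianReal_absolutelyContinuous (fun _ => 0) _ fun p => ?_
  split_ifs <;> norm_num

/-- The quadratic form `xᵀ Q x` of the symmetric matrix `Q` with upper-triangular entries `w`. -/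
def goeForm {n : ℕ} (w : UpperIndex n → ℝ) (x : Fin n → ℝ) : ℝ := x ⬝ᵥ (goeMatrix w *ᵥ x)

theorem goeForm_eq_sum {n : ℕ} (w : UpperIndex n → ℝ) (x : Fin n → ℝ) :
    goeForm w x = ∑ i, ∑ j, x i * x j * goeMatrix w i j := by
  simp only [goeForm, dotProduct, Matrix.mulVec, Finset.mul_sum]
  exact Finset.sum_congr rfl fun i _ => Finset.sum_congr rfl fun j _ => by ring

/-- The weights `x i * x j` are nonnegative with sum `1`, so the form is an average of matrix
entries. This makes the optimal value `1`-Lipschitz for the sup distance. -/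
theorem goeForm_le_add_dist {n : ℕ} (w w' : UpperIndex n → ℝ) {x : Fin n → ℝ}
    (hx : x ∈ stdSimplex ℝ (Fin n)) : goeForm w x ≤ goeForm w' x + dist w w' := by
  have hsum : ∑ i, ∑ j, x i * x j = 1 := by
    simp_rw [← Finset.mul_sum, hx.2, mul_one]
    exact hx.2
  calc goeForm w x ≤ ∑ i, ∑ j, (x i * x j * goeMatrix w' i j + x i * x j * dist w w') := by
        rw [goeForm_eq_sum]
        refine Finset.sum_le_sum fun i _ => Finset.sum_le_sum fun j _ => ?_
        rw [← mul_add]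
        refine mul_le_mul_of_nonneg_left ?_ (mul_nonneg (hx.1 i) (hx.1 j))
        have h := dist_le_pi_dist w w' ⟨(min i j, max i j), min_le_max⟩
        rw [Real.dist_eq] at h
        have h' := (abs_le.1 h).2
        simp only [goeMatrix, Matrix.of_apply]
        linarith
    _ = goeForm w' x + dist w w' := by
        simp_rw [Finset.sum_add_distrib, ← Finset.sum_mul]
        rw [hsum, one_mul, goeForm_eq_sum]

theorem exists_isGlobalOptimizer {n : ℕ} (hn : 1 ≤ n) (Q : Matrix (Fin n) (Fin n) ℝ) :
    ∃ x, IsGlobalOptimizer Q x := by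
  have : NeZero n := ⟨by omega⟩
  have hne : (stdSimplex ℝ (Fin n)).Nonempty := ⟨_, single_mem_stdSimplex ℝ 0⟩
  have hc : ContinuousOn (fun y : Fin n → ℝ => y ⬝ᵥ (Q *ᵥ y)) (stdSimplex ℝ (Fin n)) := by
    apply Continuous.continuousOn
    fun_prop
  obtain ⟨x, hx, hmin⟩ := (isCompact_stdSimplex ℝ (Fin n)).exists_isMinOn hne hc
  exact ⟨x, hx, hmin⟩

theorem goeForm_add_single {n : ℕ} (w : UpperIndex n → ℝ) (x : Fin n → ℝ) (i : Fin n) (t : ℝ) :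
    goeForm (w + t • Pi.single (⟨(i, i), le_rfl⟩ : UpperIndex n) (1 : ℝ)) x =
      goeForm w x + t * x i ^ 2 := by
  have hentry : ∀ a b, goeMatrix (w + t • Pi.single (⟨(i, i), le_rfl⟩ : UpperIndex n) (1 : ℝ)) a b =
      goeMatrix w a b + if a = i then (if b = i then t else 0) else 0 := by
    intro a b
    simp only [goeMatrix, Matrix.of_apply, Pi.add_apply, Pi.smul_apply, smul_eq_mul,
      Pi.single_apply, Subtype.mk.injEq, Prod.mk.injEq]
    congr 1
    rw [← ite_and]
    have : (min a b = i ∧ max a b = i) ↔ (a = i ∧ b = i) := by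
      constructor
      · rintro ⟨h1, h2⟩
        have h3 : a = b := le_antisymm
          ((le_max_left a b).trans (h2.trans h1.symm).le |>.trans (min_le_right a b))
          ((le_max_right a b).trans (h2.trans h1.symm).le |>.trans (min_le_left a b))
        subst h3
        simpa using h1
      · rintro ⟨rfl, rfl⟩
        simp
    simp [this]
  rw [goeForm_eq_sum, goeForm_eq_sum]
  simp_rw [hentry, mul_add, Finset.sum_add_distrib]
  congr 1
  simp
  ring

theorem ae_existsUnique_isGlobalOptimizer {n : ℕ} (hn : 1 ≤ n) :
    ∀ᵐ w ∂(goeMeasure n), ∃! x, IsGlobalOptimizer (goeMatrix w) x := by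
  choose X hX using fun w : UpperIndex n → ℝ => exists_isGlobalOptimizer hn (goeMatrix w)
  set V : (UpperIndex n → ℝ) → ℝ := fun w => goeForm w (X w) with hV
  have hVle : ∀ w, ∀ x ∈ stdSimplex ℝ (Fin n), V w ≤ goeForm w x := fun w x hx => (hX w).2 hx
  have hlip : LipschitzWith 1 V := LipschitzWith.of_le_add fun w w' =>
    (hVle w _ (hX w').1).trans (goeForm_le_add_dist w w' (hX w').1)
  have hae : ∀ᵐ w ∂(volume : Measure (UpperIndex n → ℝ)), DifferentiableAt ℝ V w :=
    hlip.ae_differentiableAt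
  filter_upwards [(goeMeasure_absolutelyContinuous n).ae_le hae] with w hw
  -- Envelope identity: along a diagonal direction the affine function `goeForm · x` dominates `V`
  -- and touches it at `w`, so their derivatives agree.
  have key : ∀ x, IsGlobalOptimizer (goeMatrix w) x → ∀ i,
      x i ^ 2 = fderiv ℝ V w (Pi.single (⟨(i, i), le_rfl⟩ : UpperIndex n) (1 : ℝ)) := by
    intro x hx i
    set e : UpperIndex n → ℝ := Pi.single ⟨(i, i), le_rfl⟩ 1 with he
    have hline : HasDerivAt (fun t : ℝ => w + t • e) e 0 := by
      simpa using ((hasDerivAt_id (0 : ℝ)).smul_const e).const_add w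
    have hVd : HasDerivAt (fun t : ℝ => V (w + t • e)) (fderiv ℝ V w e) 0 := by
      refine HasFDerivAt.comp_hasDerivAt (x := (0 : ℝ)) (l := V) ?_ hline
      simpa using hw.hasFDerivAt
    have hqd : HasDerivAt (fun t : ℝ => goeForm w x + t * x i ^ 2) (x i ^ 2) 0 := by
      simpa using ((hasDerivAt_id (0 : ℝ)).mul_const (x i ^ 2)).const_add (goeForm w x)
    have hmin : IsLocalMin (fun t : ℝ => (goeForm w x + t * x i ^ 2) - V (w + t • e)) 0 := by
      refine Filter.Eventually.of_forall fun t => ?_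
      have h0 : goeForm w x ≤ V w := hx.2 (hX w).1
      have h1 := hVle (w + t • e) x hx.1
      rw [goeForm_add_single] at h1
      simp only [zero_mul, zero_smul, add_zero]
      linarith
    have := hmin.hasDerivAt_eq_zero (hqd.sub hVd)
    linarith
  refine ⟨X w, hX w, fun y hy => funext fun i => ?_⟩
  have h := (key y hy i).trans (key _ (hX w) i).symm
  exact (pow_left_inj₀ (hy.1.1 i) ((hX w).1.1 i) two_ne_zero).1 h

/-! ### From optimality to a column mean below the diagonal -/

theorem isSymm_goeMatrix {n : ℕ} (w : UpperIndex n → ℝ) : (goeMatrix w).IsSymm := by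
  ext i j
  simp only [Matrix.transpose_apply, goeMatrix, Matrix.of_apply, min_comm j i, max_comm j i]

/-- First-order optimality on the support of a global optimizer of a symmetric matrix. -/
theorem IsGlobalOptimizer.mulVec_le {n : ℕ} {Q : Matrix (Fin n) (Fin n) ℝ} (hQ : Q.IsSymm)
    {x : Fin n → ℝ} (hx : IsGlobalOptimizer Q x) {i : Fin n} (hi : 0 < x i) :
    (Q *ᵥ x) i ≤ x ⬝ᵥ (Q *ᵥ x) := by
  set q := (Q *ᵥ x) i with hq
  set lam := x ⬝ᵥ (Q *ᵥ x) with hlam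
  have hstep : ∀ ε, 0 < ε → ε ≤ x i → 2 * (q - lam) ≤ ε * (lam - 2 * q + Q i i) := by
    intro ε hε hεx
    -- Moving away from vertex `i` stays feasible because `x i ≥ ε`; this is where `i` must lie in
    -- the support.
    set y : Fin n → ℝ := (1 + ε) • x - ε • Pi.single i (1 : ℝ) with hy
    have hymem : y ∈ stdSimplex ℝ (Fin n) := by
      refine ⟨fun a => ?_, ?_⟩
      · by_cases ha : a = i
        · subst ha
          simp only [hy, Pi.sub_apply, Pi.smul_apply, smul_eq_mul, Pi.single_eq_same]
          nlinarith
        · simp only [hy, Pi.sub_apply, Pi.smul_apply, smul_eq_mul, Pi.single_eq_of_ne ha]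
          have := hx.1.1 a
          nlinarith
      · simp only [hy, Pi.sub_apply, Pi.smul_apply, smul_eq_mul, Finset.sum_sub_distrib,
          ← Finset.mul_sum, hx.1.2, Finset.sum_pi_single']
        simp
    have hmin : lam ≤ y ⬝ᵥ (Q *ᵥ y) := hx.2 hymem
    have hsymm : x ⬝ᵥ (Q *ᵥ Pi.single i (1 : ℝ)) = q := by
      rw [Matrix.dotProduct_mulVec, ← Matrix.mulVec_transpose, hQ.eq, dotProduct_single_one]
    rw [Matrix.mulVec_single_one] at hsymm
    have hexp : y ⬝ᵥ (Q *ᵥ y) = (1 + ε) ^ 2 * lam - 2 * ε * (1 + ε) * q + ε ^ 2 * Q i i := by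
      simp only [hy, Matrix.mulVec_sub, Matrix.mulVec_smul, dotProduct_sub, sub_dotProduct,
        dotProduct_smul, smul_dotProduct, smul_eq_mul, hsymm, ← hlam, single_one_dotProduct,
        Matrix.mulVec_single_one, Matrix.col_apply, ← hq]
      ring
    rw [hexp] at hmin
    have : 0 ≤ ε * (ε * (lam - 2 * q + Q i i) - 2 * (q - lam)) := by nlinarith
    have := nonneg_of_mul_nonneg_right this hε
    linarith
  by_contra! hlt
  have hpos : 0 < q - lam := by linarith
  set c := lam - 2 * q + Q i i
  have hc : 0 < |c| + 1 := by positivity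
  -- With this step size the right side of `hstep` is at most `q - lam`, contradicting `2 * (q -
  -- lam)` on the left.
  have h := hstep (min (x i) ((q - lam) / (|c| + 1))) (lt_min hi (by positivity)) (min_le_left _ _)
  have h1 : min (x i) ((q - lam) / (|c| + 1)) * c ≤ (q - lam) / (|c| + 1) * (|c| + 1) := by
    refine mul_le_mul_of_nonneg (min_le_right _ _) ?_ (lt_min hi (by positivity)).le hc.le
    linarith [le_abs_self c]
  rw [div_mul_cancel₀ _ hc.ne'] at h1
  linarith

theorem IsGlobalOptimizer.le_diag {n : ℕ} {Q : Matrix (Fin n) (Fin n) ℝ}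
    {x : Fin n → ℝ} (hx : IsGlobalOptimizer Q x) (l : Fin n) : x ⬝ᵥ (Q *ᵥ x) ≤ Q l l := by
  have h : x ⬝ᵥ (Q *ᵥ x) ≤ Pi.single l (1 : ℝ) ⬝ᵥ (Q *ᵥ Pi.single l (1 : ℝ)) :=
    hx.2 (single_mem_stdSimplex ℝ l)
  simpa using h

/-- The mean over the rows in `S` of the `j`-th column of the GOE matrix. -/
noncomputable def columnMean {n : ℕ} (S : Finset (Fin n)) (j : Fin n) (w : UpperIndex n → ℝ) : ℝ :=
  (∑ i ∈ S, goeMatrix w i j) / S.card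

/-- By symmetry of the double sum, `∑_{i∈S} (Qx)_i` is the `x`-weighted average of the column sums
over `S`. It is at most `|S| λ`, so some column sum is too. -/
theorem IsGlobalOptimizer.exists_columnMean_le {n : ℕ} {w : UpperIndex n → ℝ} {x : Fin n → ℝ}
    (hx : IsGlobalOptimizer (goeMatrix w) x) {S : Finset (Fin n)} (hS : ∀ i, i ∈ S ↔ 0 < x i) :
    ∃ j ∈ S, ∀ l, columnMean S j w ≤ goeMatrix w l l := by
  set Q := goeMatrix w with hQdef
  have hsum : ∑ j ∈ S, x j = 1 := by
    rw [← hx.1.2]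
    refine Finset.sum_subset (Finset.subset_univ S) fun i _ hi => ?_
    rw [hS] at hi
    exact le_antisymm (not_lt.1 hi) (hx.1.1 i)
  set lam := x ⬝ᵥ (Q *ᵥ x)
  have h1 : ∑ i ∈ S, (Q *ᵥ x) i ≤ ∑ i ∈ S, lam :=
    Finset.sum_le_sum fun i hi => hx.mulVec_le (isSymm_goeMatrix w) ((hS i).1 hi)
  have h2 : ∑ j ∈ S, x j * ∑ i ∈ S, Q i j = ∑ i ∈ S, (Q *ᵥ x) i := by
    simp only [Matrix.mulVec, dotProduct, Finset.mul_sum]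
    rw [Finset.sum_comm]
    refine Finset.sum_congr rfl fun i _ => ?_
    rw [← Finset.sum_subset (Finset.subset_univ S)]
    · exact Finset.sum_congr rfl fun j _ => mul_comm _ _
    · intro j _ hj
      rw [hS] at hj
      rw [le_antisymm (not_lt.1 hj) (hx.1.1 j), mul_zero]
  have h3 : ∑ j ∈ S, x j * ∑ i ∈ S, Q i j ≤ ∑ j ∈ S, x j * (S.card * lam) := by
    rw [h2, ← Finset.sum_mul, hsum, one_mul]
    simpa using h1
  have hne : S.Nonempty := by
    by_contra h
    rw [Finset.not_nonempty_iff_eq_empty] at h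
    simp [h] at hsum
  obtain ⟨j, hj, hle⟩ := Finset.exists_le_of_sum_le hne h3
  refine ⟨j, hj, fun l => ?_⟩
  have hcard : (0 : ℝ) < S.card := by exact_mod_cast hne.card_pos
  have := le_of_mul_le_mul_left hle ((hS j).1 hj)
  refine le_trans ?_ (hx.le_diag l)
  rw [columnMean, div_le_iff₀ hcard, mul_comm]
  exact this

/-- Positivity of `kappa` excludes its default value `0`, so a unique optimizer is available. -/
theorem exists_columnMean_le_of_kappa {n : ℕ} {w : UpperIndex n → ℝ} (hk : 0 < kappa (goeMatrix w)) :
    ∃ S : Finset (Fin n), S.card = kappa (goeMatrix w) ∧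
      ∃ j ∈ S, ∀ l, columnMean S j w ≤ goeMatrix w l l := by
  classical
  by_cases h : ∃! x, IsGlobalOptimizer (goeMatrix w) x
  · refine ⟨Finset.univ.filter fun i => 0 < h.choose i, ?_,
      h.choose_spec.1.exists_columnMean_le fun i => by simp⟩
    rw [kappa, dif_pos h, ← Set.ncard_coe_finset]
    simp
  · rw [kappa, dif_neg h] at hk
    exact absurd hk (lt_irrefl 0)

theorem kappa_le {n : ℕ} (w : UpperIndex n → ℝ) : kappa (goeMatrix w) ≤ n := by
  rcases Nat.eq_zero_or_pos (kappa (goeMatrix w)) with h | h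
  · omega
  · obtain ⟨S, hS, -⟩ := exists_columnMean_le_of_kappa h
    rw [← hS]
    simpa using S.card_le_univ

/-! ### Laws of column means and of the diagonal -/

theorem map_finsetSum_gaussianReal {Ω ι : Type*} {mΩ : MeasurableSpace Ω} {P : Measure Ω}
    [IsProbabilityMeasure P] {X : ι → Ω → ℝ} {v : ι → ℝ≥0} (hX : iIndepFun X P)
    (hm : ∀ i, Measurable (X i)) (hlaw : ∀ i, P.map (X i) = gaussianReal 0 (v i)) (s : Finset ι) :
    P.map (∑ i ∈ s, X i) = gaussianReal 0 (∑ i ∈ s, v i) := by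
  classical
  induction s using Finset.induction_on with
  | empty =>
    rw [Finset.sum_empty, Finset.sum_empty, gaussianReal_zero_var]
    exact (Measure.map_const P (0 : ℝ)).trans (by simp)
  | insert a s ha ih =>
    rw [Finset.sum_insert ha, Finset.sum_insert ha, add_comm, add_comm (v a)]
    simpa using gaussianReal_add_gaussianReal_of_indepFun
      (hX.indepFun_finsetSum_of_notMem hm ha) ih (hlaw a)

theorem iIndepFun_goeMeasure (n : ℕ) :
    iIndepFun (fun (p : UpperIndex n) (w : UpperIndex n → ℝ) => w p) (goeMeasure n) :=
  iIndepFun_pi (X := fun _ => id) fun _ => aemeasurable_id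

theorem map_eval_goeMeasure (n : ℕ) (p : UpperIndex n) :
    (goeMeasure n).map (fun w => w p) = gaussianReal 0 (if p.1.1 = p.1.2 then 1 else 1 / 2) :=
  (measurePreserving_eval
    (fun p : UpperIndex n => gaussianReal 0 (if p.1.1 = p.1.2 then 1 else 1 / 2)) p).map_eq

/-- The position on or above the diagonal that carries the matrix entry `(i, j)`. -/
def upperIndex {n : ℕ} (j i : Fin n) : UpperIndex n := ⟨(min i j, max i j), min_le_max⟩

theorem upperIndex_injective {n : ℕ} (j : Fin n) : Function.Injective (upperIndex j) := by
  intro a b h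
  simp only [upperIndex, Subtype.mk.injEq, Prod.mk.injEq, Fin.ext_iff, Fin.coe_min,
    Fin.coe_max] at h
  ext
  omega

theorem upperIndex_diag_iff {n : ℕ} (j i : Fin n) :
    (upperIndex j i).1.1 = (upperIndex j i).1.2 ↔ i = j := by
  simp only [upperIndex, Fin.ext_iff, Fin.coe_min, Fin.coe_max]
  omega

theorem upperIndex_self {n : ℕ} (l : Fin n) : upperIndex l l = ⟨(l, l), le_rfl⟩ := by
  simp [upperIndex]

theorem measurable_columnMean {n : ℕ} (S : Finset (Fin n)) (j : Fin n) :
    Measurable (columnMean S j) :=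
  (Finset.measurable_sum S fun i _ => measurable_pi_apply (upperIndex j i)).div_const _

theorem sigmaSq_nonneg (k : ℕ) : 0 ≤ sigmaSq k := by
  unfold sigmaSq
  positivity

/-- The column means of the GOE matrix are Gaussian. -/
theorem map_columnMean {n : ℕ} {S : Finset (Fin n)} {j : Fin n} (hj : j ∈ S) :
    (goeMeasure n).map (columnMean S j) = gaussianReal 0 (sigmaSq S.card).toNNReal := by
  have hpos : 0 < S.card := Finset.card_pos.2 ⟨j, hj⟩
  have h1 := map_finsetSum_gaussianReal
    ((iIndepFun_goeMeasure n).precomp (upperIndex_injective j))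
    (fun i => measurable_pi_apply (upperIndex j i))
    (fun i => map_eval_goeMeasure n (upperIndex j i)) S
  have h2 : columnMean S j = (fun x => x / (S.card : ℝ)) ∘
      (∑ i ∈ S, fun w : UpperIndex n → ℝ => w (upperIndex j i)) := by
    funext w
    simp [columnMean, goeMatrix, upperIndex]
  rw [h2, ← Measure.map_map (measurable_id'.div_const _), h1, gaussianReal_map_div_const, zero_div]
  · congr 1
    ext
    rw [Real.coe_toNNReal _ (sigmaSq_nonneg _)]
    simp only [upperIndex_diag_iff, NNReal.coe_div, NNReal.coe_mk, NNReal.coe_sum]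
    have : ∑ i ∈ S, (((if i = j then 1 else 1 / 2 : ℝ≥0)) : ℝ) = ((S.card : ℝ) + 1) / 2 := by
      rw [← Finset.add_sum_erase S _ hj, if_pos rfl, Finset.sum_congr rfl
        (g := fun _ => (1 / 2 : ℝ)) fun i hi => by
          rw [if_neg (Finset.ne_of_mem_erase hi)]; norm_num]
      rw [Finset.sum_const, Finset.card_erase_of_mem hj, nsmul_eq_mul, Nat.cast_sub hpos]
      push_cast
      ring
    rw [this, sigmaSq]
    field_simp
  · fun_prop

theorem goeMeasure_forall_le_diag {n : ℕ} (T : Finset (Fin n)) (r : ℝ) :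
    goeMeasure n {w | ∀ l ∈ T, r ≤ goeMatrix w l l} =
      gaussianReal 0 1 (Set.Ici r) ^ T.card := by
  have hinj : Function.Injective fun l : Fin n => upperIndex l l := by
    intro a b h
    simpa [upperIndex_self] using h
  have h := ((iIndepFun_goeMeasure n).precomp hinj).measure_inter_preimage_eq_mul T
    (sets := fun _ => Set.Ici r) fun _ _ => measurableSet_Ici
  have hset : {w : UpperIndex n → ℝ | ∀ l ∈ T, r ≤ goeMatrix w l l} =
      ⋂ l ∈ T, (fun w : UpperIndex n → ℝ => w (upperIndex l l)) ⁻¹' Set.Ici r := by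
    ext w
    simp [goeMatrix, upperIndex]
  rw [hset, h, Finset.prod_congr rfl (g := fun _ => gaussianReal 0 1 (Set.Ici r)),
    Finset.prod_const]
  intro l _
  rw [← Measure.map_apply (measurable_pi_apply _) measurableSet_Ici, map_eval_goeMeasure,
    if_pos ((upperIndex_diag_iff l l).2 rfl)]

/-- The probability that a column mean lies below the whole diagonal. -/
theorem goeMeasure_columnMean_le_diag {n : ℕ} {S : Finset (Fin n)} {j : Fin n} (hj : j ∈ S) :
    goeMeasure n {w | ∀ l, columnMean S j w ≤ goeMatrix w l l} ≤
      ∫⁻ r, gaussianReal 0 1 (Set.Ici r) ^ (n - 1) ∂gaussianReal 0 (sigmaSq S.card).toNNReal := by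
  classical
  -- `Q_jj` enters the mean of column `j`, so it is dropped; the other diagonal entries are
  -- independent of that mean. Hence the exponent `n - 1`.
  set T : Finset (Fin n) := Finset.univ.erase j with hT
  set A : Finset (UpperIndex n) := S.image (upperIndex j) with hA
  set B : Finset (UpperIndex n) := T.image fun l => upperIndex l l with hB
  have hdisj : Disjoint A B := by
    rw [Finset.disjoint_left]
    intro p hpA hpB
    obtain ⟨i, -, rfl⟩ := Finset.mem_image.1 hpA
    obtain ⟨l, hl, hli⟩ := Finset.mem_image.1 hpB
    have hij : i = j := (upperIndex_diag_iff j i).1 (by rw [← hli, upperIndex_self])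
    subst hij
    rw [upperIndex_self, upperIndex_self] at hli
    exact Finset.ne_of_mem_erase hl (by simpa using hli)
  have hind := (iIndepFun_goeMeasure n).indepFun_finset A B hdisj fun p => measurable_pi_apply p
  have hmemA : ∀ i : S, upperIndex j i.1 ∈ A := fun i => Finset.mem_image_of_mem _ i.2
  have hmemB : ∀ l : T, upperIndex l.1 l.1 ∈ B := fun l =>
    Finset.mem_image_of_mem (fun l => upperIndex l l) l.2
  have hφ : Measurable fun u : A → ℝ => (∑ i : S, u ⟨_, hmemA i⟩) / (S.card : ℝ) :=
    by fun_prop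
  have hψ : Measurable fun (u : B → ℝ) (l : T) => u ⟨_, hmemB l⟩ :=
    measurable_pi_lambda _ fun l => measurable_pi_apply _
  have hind2 := hind.comp hφ hψ
  have hR : ((fun u : A → ℝ => (∑ i : S, u ⟨_, hmemA i⟩) / (S.card : ℝ)) ∘
      fun (w : UpperIndex n → ℝ) (i : A) => w i) = columnMean S j := by
    funext w
    simp only [Function.comp, columnMean, goeMatrix, Matrix.of_apply, upperIndex]
    rw [← Finset.sum_coe_sort S]
  set V : (UpperIndex n → ℝ) → T → ℝ := fun w l => goeMatrix w l l with hV
  have hVm : Measurable V := measurable_pi_lambda _ fun l => measurable_pi_apply (upperIndex l.1 l.1)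
  rw [hR] at hind2
  replace hind2 : IndepFun (columnMean S j) V (goeMeasure n) := hind2
  have hRm := measurable_columnMean S j
  have hmap := (indepFun_iff_map_prod_eq_prod_map_map hRm.aemeasurable hVm.aemeasurable).1 hind2
  set E : Set (ℝ × (T → ℝ)) := {q | ∀ l, q.1 ≤ q.2 l} with hE
  have hEm : MeasurableSet E := by
    rw [hE, Set.ofPred_forall]
    exact MeasurableSet.iInter fun l =>
      measurableSet_le measurable_fst ((measurable_pi_apply l).comp measurable_snd)
  calc goeMeasure n {w | ∀ l, columnMean S j w ≤ goeMatrix w l l}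
      ≤ goeMeasure n ((fun w => (columnMean S j w, V w)) ⁻¹' E) :=
        measure_mono fun w hw l => hw l
    _ = ∫⁻ r, (goeMeasure n).map V (Prod.mk r ⁻¹' E) ∂(goeMeasure n).map (columnMean S j) := by
        rw [← Measure.map_apply (hRm.prodMk hVm) hEm, hmap, Measure.prod_apply hEm]
    _ = _ := by
        rw [map_columnMean hj]
        refine lintegral_congr fun r => ?_
        rw [Measure.map_apply hVm (measurable_prodMk_left hEm)]
        have : V ⁻¹' (Prod.mk r ⁻¹' E) = {w | ∀ l ∈ T, r ≤ goeMatrix w l l} := by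
          ext w
          simp [hE, hV]
        rw [this, goeMeasure_forall_le_diag, hT, Finset.card_erase_of_mem (Finset.mem_univ j),
          Finset.card_univ, Fintype.card_fin]

/-! ### Gaussian tail estimates -/

/-- Chernoff's bound at the optimal parameter `-t/v`; for `v = 0` division by zero makes the right
side `1`. -/
theorem gaussianReal_Iic_neg_le (v : ℝ≥0) {t : ℝ} (ht : 0 ≤ t) :
    (gaussianReal 0 v).real (Set.Iic (-t)) ≤ Real.exp (-(t ^ 2 / (2 * v))) := by
  have h := measure_le_le_exp_mul_mgf (μ := gaussianReal 0 v) (X := id) (t := -(t / v)) (-t)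
    (neg_nonpos.2 (div_nonneg ht v.2)) (integrable_exp_mul_gaussianReal _)
  rw [mgf_id_gaussianReal, ← Real.exp_add] at h
  refine h.trans (Real.exp_le_exp.2 (le_of_eq ?_))
  rcases eq_or_ne (v : ℝ) 0 with hv | hv
  · simp [hv]
  · field_simp
    ring

/-- The distribution function of the standard normal law. -/
noncomputable def normalCDF (r : ℝ) : ℝ := (gaussianReal 0 1).real (Set.Iic r)

theorem normalCDF_eq_integral (r : ℝ) :
    normalCDF r = ∫ x in Set.Iic r, gaussianPDFReal 0 1 x := by
  rw [normalCDF, Measure.real, gaussianReal_apply_eq_integral _ one_ne_zero,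
    ENNReal.toReal_ofReal (integral_nonneg fun x => gaussianPDFReal_nonneg _ _ x)]

theorem continuous_gaussianPDFReal (m : ℝ) (v : ℝ≥0) : Continuous (gaussianPDFReal m v) := by
  unfold gaussianPDFReal
  fun_prop

theorem hasDerivAt_normalCDF (r : ℝ) : HasDerivAt normalCDF (gaussianPDFReal 0 1 r) r := by
  have hint := integrable_gaussianPDFReal 0 1
  have h : normalCDF = fun x => (∫ y in r..x, gaussianPDFReal 0 1 y) + normalCDF r := by
    funext x
    rw [← intervalIntegral.integral_Iic_sub_Iic hint.integrableOn hint.integrableOn,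
      normalCDF_eq_integral, normalCDF_eq_integral]
    ring
  rw [h]
  refine HasDerivAt.add_const _ (intervalIntegral.integral_hasDerivAt_right ?_ ?_ ?_)
  · exact hint.intervalIntegrable
  · exact (continuous_gaussianPDFReal 0 1).stronglyMeasurableAtFilter _ _
  · exact (continuous_gaussianPDFReal 0 1).continuousAt

theorem normalCDF_nonneg (r : ℝ) : 0 ≤ normalCDF r := measureReal_nonneg

theorem monotone_normalCDF : Monotone normalCDF := fun _ _ h =>
  measureReal_mono (Set.Iic_subset_Iic.2 h)

theorem gaussianReal_Ici_le (r : ℝ) :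
    gaussianReal 0 1 (Set.Ici r) ≤ ENNReal.ofReal (Real.exp (-normalCDF r)) := by
  have : NullSingletonClass (gaussianReal 0 1) := nullSingletonClass_gaussianReal one_ne_zero
  rw [← measure_congr Ioi_ae_eq_Ici, ← Set.compl_Iic,
    ← ENNReal.ofReal_toReal (measure_ne_top _ (Set.Iic r)ᶜ)]
  refine ENNReal.ofReal_le_ofReal ?_
  change (gaussianReal 0 1).real _ ≤ _
  rw [probReal_compl_eq_one_sub measurableSet_Iic]
  have := Real.add_one_le_exp (-normalCDF r)
  rw [normalCDF] at *
  linarith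

theorem gaussianReal_Ici_pow_le (r : ℝ) (m : ℕ) :
    gaussianReal 0 1 (Set.Ici r) ^ m ≤ ENNReal.ofReal (Real.exp (-(m * normalCDF r))) := by
  refine (pow_le_pow_left' (gaussianReal_Ici_le r) m).trans ?_
  rw [← ENNReal.ofReal_pow (Real.exp_pos _).le, ← Real.exp_nat_mul, mul_neg]

/-- A Mills-type lower bound for the lower tail of the standard normal law. -/
theorem gaussianPDFReal_le_mul_normalCDF {s : ℝ} (hs : 1 ≤ s) :
    gaussianPDFReal 0 1 (-s) ≤ Real.exp (3 / 2) * s * normalCDF (-s) := by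
  have hs0 : 0 < s := by linarith
  have hint := integrable_gaussianPDFReal 0 1
  -- On `[-s - 1/s, -s]` the density loses at most a factor `e^(-3/2)`, since `(s + 1/s)² ≤ s² + 3`
  -- for `s ≥ 1`.
  have h1 : (1 / s) * (Real.exp (-(3 / 2)) * gaussianPDFReal 0 1 (-s)) ≤ normalCDF (-s) := by
    rw [normalCDF_eq_integral]
    have hle : -s - 1 / s ≤ -s := by
      have : 0 < 1 / s := by positivity
      linarith
    have hvol : volume.real (Set.Icc (-s - 1 / s) (-s)) = 1 / s := by
      rw [Real.volume_real_Icc_of_le hle]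
      ring
    rw [← hvol, ← smul_eq_mul (volume.real _)]
    refine (setIntegral_ge_of_const_le measurableSet_Icc (by simp) ?_ hint.integrableOn).trans
      (setIntegral_mono_set hint.integrableOn
        (ae_of_all _ fun x => gaussianPDFReal_nonneg _ _ x)
        (Set.Icc_subset_Iic_self.eventuallyLE))
    intro x hx
    simp only [gaussianPDFReal, sub_zero, NNReal.coe_one, mul_one]
    rw [mul_left_comm, ← Real.exp_add]
    refine mul_le_mul_of_nonneg_left (Real.exp_le_exp.2 ?_) (by positivity)
    have h2 : 1 / s ≤ 1 := by
      rw [div_le_one hs0]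
      exact hs
    have h3 : s * (1 / s) = 1 := by field_simp
    have h4 : 0 < 1 / s := by positivity
    have h5 : -x ≤ s + 1 / s := by linarith [hx.1]
    have h6 : 0 ≤ -x := by linarith [hx.2]
    have h7 : (-x) ^ 2 ≤ (s + 1 / s) ^ 2 := pow_le_pow_left₀ h6 h5 2
    nlinarith
  have h2 : Real.exp (3 / 2) * Real.exp (-(3 / 2)) = 1 := by
    rw [← Real.exp_add]
    simp
  calc gaussianPDFReal 0 1 (-s)
      = Real.exp (3 / 2) * s * ((1 / s) * (Real.exp (-(3 / 2)) * gaussianPDFReal 0 1 (-s))) := by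
        field_simp
        rw [mul_assoc, h2, mul_one]
    _ ≤ _ := mul_le_mul_of_nonneg_left h1 (by positivity)

theorem normalCDF_pos {r : ℝ} (hr : -1 ≤ r) : 0 < normalCDF r := by
  have h := gaussianPDFReal_le_mul_normalCDF le_rfl
  have hpos := gaussianPDFReal_pos 0 1 (-1) one_ne_zero
  have h1 : 0 < normalCDF (-1) := by
    by_contra hneg
    have := mul_nonpos_of_nonneg_of_nonpos (by positivity : 0 ≤ Real.exp (3 / 2) * 1)
      (not_lt.1 hneg)
    linarith
  exact h1.trans_le (monotone_normalCDF hr)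

/-! ### The one-dimensional integral -/

theorem exists_exp_neg_mul_le_rpow (s : ℝ) {b : ℝ} (hb : 0 < b) :
    ∃ C : ℝ, 0 < C ∧ ∀ n : ℕ, 1 ≤ n → Real.exp (-(b * n)) ≤ C * (n : ℝ) ^ (-s) := by
  obtain ⟨C, hC⟩ := ((tendsto_rpow_mul_exp_neg_mul_atTop_nhds_zero s b hb).comp
    tendsto_natCast_atTop_atTop).bddAbove_range
  refine ⟨max C 1, by positivity, fun n hn => ?_⟩
  have hn0 : (0 : ℝ) < n := by exact_mod_cast hn
  have h : (n : ℝ) ^ s * Real.exp (-b * n) ≤ max C 1 :=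
    (hC (Set.mem_range_self n)).trans (le_max_left _ _)
  rw [Real.rpow_neg hn0.le, ← div_eq_mul_inv, le_div_iff₀ (by positivity), mul_comm, ← neg_mul]
  exact h

theorem gaussianPDFReal_eq_mul_rpow {a : ℝ} (ha : 0 < a) (r : ℝ) :
    gaussianPDFReal 0 a⁻¹.toNNReal r =
      (√(2 * Real.pi * a⁻¹))⁻¹ * √(2 * Real.pi) ^ a * gaussianPDFReal 0 1 r ^ a := by
  have h2 : (0 : ℝ) < √(2 * Real.pi) := by positivity
  simp only [gaussianPDFReal, sub_zero, NNReal.coe_one, mul_one]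
  rw [Real.coe_toNNReal _ (by positivity), Real.mul_rpow (by positivity) (Real.exp_pos _).le,
    Real.inv_rpow h2.le, ← Real.exp_mul, mul_assoc _ (√(2 * Real.pi) ^ a),
    mul_inv_cancel_left₀ (by positivity)]
  congr 2
  field_simp

/-- The substitution `u = normalCDF r` bounds the contribution of the window `[-ℓ, -1]`. -/
theorem integral_gaussianPDFReal_mul_le {a m : ℝ} (ha : 1 < a) (hm : 0 < m) {l : ℝ} (hl : 1 ≤ l) :
    ∫ r in (-l)..(-1), normalCDF r ^ (a - 1) * Real.exp (-(m * normalCDF r)) *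
      gaussianPDFReal 0 1 r ≤ (1 / m) ^ a * Real.Gamma a := by
  have hg : Continuous fun u : ℝ => u ^ (a - 1) * Real.exp (-(m * u)) :=
    (Real.continuous_rpow_const (by linarith)).mul (by fun_prop)
  have h := intervalIntegral.integral_comp_mul_deriv (a := -l) (b := -1)
    (fun x _ => hasDerivAt_normalCDF x) (continuous_gaussianPDFReal 0 1).continuousOn hg
  simp only [Function.comp] at h
  rw [h, intervalIntegral.integral_of_le (monotone_normalCDF (by linarith)),
    ← Real.integral_rpow_mul_exp_neg_mul_Ioi (by linarith) hm]
  refine setIntegral_mono_set ?_ ?_ ?_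
  · have := integrableOn_rpow_mul_exp_neg_mul_rpow (p := 1) (s := a - 1) (b := m)
      (by linarith) one_pos hm
    simpa using this
  · refine (ae_restrict_iff' measurableSet_Ioi).2 (ae_of_all _ fun u hu => ?_)
    exact mul_nonneg (Real.rpow_nonneg (le_of_lt hu) _) (Real.exp_pos _).le
  · exact (Set.Ioc_subset_Ioi_self.trans
      (Set.Ioi_subset_Ioi (normalCDF_nonneg _))).eventuallyLE

theorem setLIntegral_gaussianReal_Ici_pow_le {a : ℝ} (ha : 1 < a) {m : ℕ} (hm : 0 < m) {l : ℝ}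
    (hl : 1 ≤ l) :
    ∫⁻ r in Set.Ioc (-l) (-1), gaussianReal 0 1 (Set.Ici r) ^ m ∂gaussianReal 0 a⁻¹.toNNReal ≤
      ENNReal.ofReal ((√(2 * Real.pi * a⁻¹))⁻¹ * √(2 * Real.pi) ^ a *
        (Real.exp (3 / 2) * l) ^ (a - 1) * ((1 / m) ^ a * Real.Gamma a)) := by
  have ha0 : 0 < a := by linarith
  have hv : a⁻¹.toNNReal ≠ 0 := by simpa using ha0
  have hm' : (0 : ℝ) < m := by exact_mod_cast hm
  set K := (√(2 * Real.pi * a⁻¹))⁻¹ * √(2 * Real.pi) ^ a * (Real.exp (3 / 2) * l) ^ (a - 1)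
    with hK
  have hK0 : 0 ≤ K := by positivity
  set G : ℝ → ℝ := fun r => normalCDF r ^ (a - 1) * Real.exp (-(m * normalCDF r)) *
    gaussianPDFReal 0 1 r with hG
  have hcdf : Continuous normalCDF :=
    continuous_iff_continuousAt.2 fun r => (hasDerivAt_normalCDF r).continuousAt
  have hGc : Continuous G :=
    ((hcdf.rpow_const fun _ => Or.inr (by linarith)).mul (by fun_prop)).mul
      (continuous_gaussianPDFReal 0 1)
  have hG0 : ∀ r, 0 ≤ G r := fun r => mul_nonneg (mul_nonneg
    (Real.rpow_nonneg (normalCDF_nonneg r) _) (Real.exp_pos _).le) (gaussianPDFReal_nonneg _ _ r)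
  have hEm : Measurable fun r => ENNReal.ofReal (Real.exp (-(m * normalCDF r))) :=
    (by fun_prop : Continuous fun r => Real.exp (-(m * normalCDF r))).measurable.ennreal_ofReal
  calc _ ≤ ∫⁻ r in Set.Ioc (-l) (-1), ENNReal.ofReal (Real.exp (-(m * normalCDF r)))
          ∂gaussianReal 0 a⁻¹.toNNReal := lintegral_mono fun r => gaussianReal_Ici_pow_le r m
    _ = ∫⁻ r in Set.Ioc (-l) (-1), gaussianPDF 0 a⁻¹.toNNReal r *
          ENNReal.ofReal (Real.exp (-(m * normalCDF r))) := by
        rw [gaussianReal_of_var_ne_zero _ hv, setLIntegral_withDensity_eq_setLIntegral_mul _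
          (measurable_gaussianPDF _ _) hEm measurableSet_Ioc]
        rfl
    _ ≤ ∫⁻ r in Set.Ioc (-l) (-1), ENNReal.ofReal (K * G r) := by
        refine setLIntegral_mono (by fun_prop) fun r hr => ?_
        rw [gaussianPDF, ← ENNReal.ofReal_mul (gaussianPDFReal_nonneg _ _ _)]
        refine ENNReal.ofReal_le_ofReal ?_
        have hφ := gaussianPDFReal_nonneg 0 1 r
        have hφ' := gaussianPDFReal_pos 0 1 r one_ne_zero
        have hmills : gaussianPDFReal 0 1 r ≤ Real.exp (3 / 2) * l * normalCDF r := by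
          have h := gaussianPDFReal_le_mul_normalCDF (s := -r) (by linarith [hr.2])
          rw [neg_neg] at h
          refine h.trans ?_
          have hrl : -r ≤ l := by linarith [hr.1]
          have := normalCDF_nonneg r
          gcongr
        -- One factor `φ` is kept as the Jacobian of `u = Φ(r)`; Mills' bound converts the other `a
        -- - 1` into powers of `Φ`.
        have hpow : gaussianPDFReal 0 1 r ^ a ≤
            gaussianPDFReal 0 1 r * ((Real.exp (3 / 2) * l) ^ (a - 1) * normalCDF r ^ (a - 1)) := by
          rw [← Real.mul_rpow (by positivity) (normalCDF_nonneg r)]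
          calc gaussianPDFReal 0 1 r ^ a
              = gaussianPDFReal 0 1 r * gaussianPDFReal 0 1 r ^ (a - 1) := by
                rw [Real.rpow_sub_one hφ'.ne']
                field_simp
            _ ≤ _ := mul_le_mul_of_nonneg_left
                (Real.rpow_le_rpow hφ hmills (by linarith)) hφ
        rw [gaussianPDFReal_eq_mul_rpow ha0]
        calc _ ≤ (√(2 * Real.pi * a⁻¹))⁻¹ * √(2 * Real.pi) ^ a * (gaussianPDFReal 0 1 r *
              ((Real.exp (3 / 2) * l) ^ (a - 1) * normalCDF r ^ (a - 1))) *
                Real.exp (-(m * normalCDF r)) := by gcongr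
          _ = K * G r := by
              rw [hK, hG]
              ring
    _ = ENNReal.ofReal (∫ r in Set.Ioc (-l) (-1), K * G r) := by
        rw [ofReal_integral_eq_lintegral_ofReal]
        · exact ((hGc.const_mul K).integrableOn_Icc).mono_set Set.Ioc_subset_Icc_self
        · exact ae_of_all _ fun r => mul_nonneg hK0 (hG0 r)
    _ ≤ _ := by
        refine ENNReal.ofReal_le_ofReal ?_
        rw [integral_const_mul, ← intervalIntegral.integral_of_le (by linarith)]
        exact mul_le_mul_of_nonneg_left (integral_gaussianPDFReal_mul_le ha hm' hl) hK0

theorem one_le_sqrt_mul_log {c : ℝ} (hc : 3 / 2 ≤ c) {n : ℕ} (hn : 2 ≤ n) :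
    1 ≤ √(c * Real.log n) := by
  have h2 : Real.log 2 ≤ Real.log n :=
    Real.log_le_log (by norm_num) (by exact_mod_cast hn)
  have := Real.log_two_gt_d9
  rw [Real.one_le_sqrt]
  nlinarith

/-- The line is cut at `-√(2 log n)` and `-1`. The left tail has mass at most `n^(-a)`, the part
right of `-1` is exponentially small, and the middle window supplies the logarithm through `|r| ≤
√(2 log n)`. -/
theorem exists_lintegral_gaussianReal_Ici_pow_le {a : ℝ} (ha : 1 < a) :
    ∃ C : ℝ, 0 < C ∧ ∀ n : ℕ, 2 ≤ n →
      ∫⁻ r, gaussianReal 0 1 (Set.Ici r) ^ (n - 1) ∂gaussianReal 0 a⁻¹.toNNReal ≤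
        ENNReal.ofReal (C * (n : ℝ) ^ (-a) * Real.log n ^ ((a - 1) / 2)) := by
  have ha0 : 0 < a := by linarith
  obtain ⟨C₁, hC₁, hexp⟩ := exists_exp_neg_mul_le_rpow a (normalCDF_pos (le_refl (-1)))
  set c := normalCDF (-1) with hc
  set β := (a - 1) / 2 with hβ
  have hβ0 : 0 < β := by rw [hβ]; linarith
  have hlog2 : 0 < Real.log 2 := Real.log_pos (by norm_num)
  set K₀ := (√(2 * Real.pi * a⁻¹))⁻¹ * √(2 * Real.pi) ^ a * Real.exp (3 / 2) ^ (a - 1) with hK₀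
  have hΓ := Real.Gamma_pos_of_pos ha0
  -- Division by `Real.log 2 ^ β` gives the two outer pieces the logarithmic factor they lack.
  refine ⟨K₀ * 2 ^ β * 2 ^ a * Real.Gamma a + (1 + Real.exp c * C₁) / Real.log 2 ^ β,
    by positivity, fun n hn => ?_⟩
  have hn0 : (0 : ℝ) < n := by positivity
  have hn2 : (2 : ℝ) ≤ n := by exact_mod_cast hn
  have hlog : Real.log 2 ≤ Real.log n := Real.log_le_log (by norm_num) hn2
  have hlog0 : 0 < Real.log n := hlog2.trans_le hlog
  set l := √(2 * Real.log n) with hl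
  have hl1 : 1 ≤ l := one_le_sqrt_mul_log (by norm_num) hn
  have hcast : ((n - 1 : ℕ) : ℝ) = n - 1 := by
    rw [Nat.cast_sub (by omega)]
    simp
  have hcover : (Set.univ : Set ℝ) ⊆ (Set.Iic (-l) ∪ Set.Ioc (-l) (-1)) ∪ Set.Ioi (-1) := by
    intro r _
    rcases le_or_gt r (-l) with h | h
    · exact Or.inl (Or.inl h)
    · rcases le_or_gt r (-1) with h' | h'
      · exact Or.inl (Or.inr ⟨h, h'⟩)
      · exact Or.inr h'
  set ν := gaussianReal 0 a⁻¹.toNNReal with hν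
  have hA : ∫⁻ r in Set.Iic (-l), gaussianReal 0 1 (Set.Ici r) ^ (n - 1) ∂ν ≤
      ENNReal.ofReal ((n : ℝ) ^ (-a)) := by
    calc _ ≤ ∫⁻ _ in Set.Iic (-l), 1 ∂ν :=
          lintegral_mono fun r => pow_le_one₀ zero_le prob_le_one
      _ = ENNReal.ofReal (ν.real (Set.Iic (-l))) := by
          rw [setLIntegral_one, Measure.real, ENNReal.ofReal_toReal (measure_ne_top _ _)]
      _ ≤ _ := by
          refine ENNReal.ofReal_le_ofReal ((gaussianReal_Iic_neg_le _ (by positivity)).trans ?_)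
          rw [Real.rpow_def_of_pos hn0, Real.coe_toNNReal _ (by positivity), hl,
            Real.sq_sqrt (by positivity)]
          refine Real.exp_le_exp.2 (le_of_eq ?_)
          field_simp
  have hB : ∫⁻ r in Set.Ioc (-l) (-1), gaussianReal 0 1 (Set.Ici r) ^ (n - 1) ∂ν ≤
      ENNReal.ofReal (K₀ * 2 ^ β * 2 ^ a * Real.Gamma a * (n : ℝ) ^ (-a) * Real.log n ^ β) := by
    refine (setLIntegral_gaussianReal_Ici_pow_le ha (by omega) hl1).trans
      (ENNReal.ofReal_le_ofReal ?_)
    have h1 : l ^ (a - 1) = 2 ^ β * Real.log n ^ β := by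
      rw [← Real.mul_rpow (by norm_num) hlog0.le, hl, Real.sqrt_eq_rpow,
        ← Real.rpow_mul (by positivity)]
      congr 1
      rw [hβ]
      ring
    have h2 : (1 / ((n - 1 : ℕ) : ℝ)) ^ a ≤ 2 ^ a * (n : ℝ) ^ (-a) := by
      rw [Real.rpow_neg hn0.le, ← Real.inv_rpow hn0.le, ← Real.mul_rpow (by norm_num) (by positivity)]
      refine Real.rpow_le_rpow (by positivity) ?_ ha0.le
      rw [hcast, ← div_eq_mul_inv, div_le_div_iff₀ (by linarith) hn0]
      linarith
    rw [Real.mul_rpow (by positivity) (by positivity), h1]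
    calc _ ≤ (√(2 * Real.pi * a⁻¹))⁻¹ * √(2 * Real.pi) ^ a *
          (Real.exp (3 / 2) ^ (a - 1) * (2 ^ β * Real.log n ^ β)) *
            ((2 ^ a * (n : ℝ) ^ (-a)) * Real.Gamma a) := by gcongr
      _ = _ := by
          rw [hK₀]
          ring
  have hC : ∫⁻ r in Set.Ioi (-1), gaussianReal 0 1 (Set.Ici r) ^ (n - 1) ∂ν ≤
      ENNReal.ofReal (Real.exp c * C₁ * (n : ℝ) ^ (-a)) := by
    calc _ ≤ ∫⁻ _ in Set.Ioi (-1), ENNReal.ofReal (Real.exp c * C₁ * (n : ℝ) ^ (-a)) ∂ν := by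
          refine setLIntegral_mono measurable_const fun r hr => ?_
          refine (gaussianReal_Ici_pow_le r _).trans (ENNReal.ofReal_le_ofReal ?_)
          calc Real.exp (-(((n - 1 : ℕ) : ℝ) * normalCDF r))
              ≤ Real.exp (c + -(c * n)) := by
                refine Real.exp_le_exp.2 ?_
                have h1 : c ≤ normalCDF r := monotone_normalCDF (le_of_lt hr)
                rw [hcast]
                nlinarith
            _ = Real.exp c * Real.exp (-(c * n)) := Real.exp_add _ _
            _ ≤ Real.exp c * (C₁ * (n : ℝ) ^ (-a)) :=
                mul_le_mul_of_nonneg_left (hexp n (by omega)) (Real.exp_pos _).le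
            _ = _ := by ring
      _ ≤ _ := by
          rw [setLIntegral_const]
          exact mul_le_of_le_one_right' prob_le_one
  calc _ = ∫⁻ r in Set.univ, gaussianReal 0 1 (Set.Ici r) ^ (n - 1) ∂ν := by
        rw [setLIntegral_univ]
    _ ≤ ∫⁻ r in (Set.Iic (-l) ∪ Set.Ioc (-l) (-1)) ∪ Set.Ioi (-1),
          gaussianReal 0 1 (Set.Ici r) ^ (n - 1) ∂ν := lintegral_mono_set hcover
    _ ≤ _ := (lintegral_union_le _ _ _).trans (add_le_add (lintegral_union_le _ _ _) le_rfl)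
    _ ≤ _ := add_le_add (add_le_add hA hB) hC
    _ = ENNReal.ofReal ((n : ℝ) ^ (-a) +
          K₀ * 2 ^ β * 2 ^ a * Real.Gamma a * (n : ℝ) ^ (-a) * Real.log n ^ β +
            Real.exp c * C₁ * (n : ℝ) ^ (-a)) := by
        rw [ENNReal.ofReal_add (by positivity) (by positivity),
          ENNReal.ofReal_add (by positivity) (by positivity)]
    _ ≤ _ := by
        refine ENNReal.ofReal_le_ofReal ?_
        have h1 : 1 ≤ Real.log n ^ β / Real.log 2 ^ β := by
          rw [one_le_div (by positivity)]
          exact Real.rpow_le_rpow hlog2.le hlog hβ0.le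
        have h2 : (1 + Real.exp c * C₁) * (n : ℝ) ^ (-a) ≤
            (1 + Real.exp c * C₁) * (n : ℝ) ^ (-a) * (Real.log n ^ β / Real.log 2 ^ β) :=
          le_mul_of_one_le_right (by positivity) h1
        calc _ = K₀ * 2 ^ β * 2 ^ a * Real.Gamma a * (n : ℝ) ^ (-a) * Real.log n ^ β +
              (1 + Real.exp c * C₁) * (n : ℝ) ^ (-a) := by ring
          _ ≤ _ := add_le_add le_rfl h2
          _ = _ := by ring

/-! ### Crude bound for the diagonal minimum -/

/-- The diagonal is exponentially unlikely to stay above `-√(9/5 log n)`. -/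
theorem exists_goeMeasure_diag_le :
    ∃ C : ℝ, 0 < C ∧ ∀ n : ℕ, 2 ≤ n →
      (goeMeasure n).real {w | ∀ l, -√(9 / 5 * Real.log n) ≤ goeMatrix w l l} ≤
        C * (n : ℝ) ^ (-(3 / 2) : ℝ) := by
  set b := Real.exp (-(3 / 2)) * (√(2 * Real.pi))⁻¹ / √18 with hb
  have hb0 : 0 < b := by positivity
  -- Since `9/5 < 2`, `n Φ(-t)` is about `n^(1/10)` up to a logarithmic factor, and `n^(1/20)` is a
  -- safe lower bound up to a constant. The power `30` turns `n^(1/20)` into `n^(3/2)`.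
  obtain ⟨C, hC⟩ := (((tendsto_rpow_mul_exp_neg_mul_atTop_nhds_zero 30 b hb0).comp
    (tendsto_rpow_atTop (by norm_num : (0 : ℝ) < 1 / 20))).comp
      tendsto_natCast_atTop_atTop).bddAbove_range
  refine ⟨max C 1, by positivity, fun n hn => ?_⟩
  have hn0 : (0 : ℝ) < n := by positivity
  have hlog0 : 0 < Real.log n := Real.log_pos (by exact_mod_cast hn)
  set t := √(9 / 5 * Real.log n) with ht
  have ht1 : 1 ≤ t := one_le_sqrt_mul_log (by norm_num) hn
  have ht0 : 0 < t := by linarith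
  have hset : {w : UpperIndex n → ℝ | ∀ l, -t ≤ goeMatrix w l l} =
      {w | ∀ l ∈ (Finset.univ : Finset (Fin n)), -t ≤ goeMatrix w l l} := by simp
  have h1 : (goeMeasure n).real {w | ∀ l, -t ≤ goeMatrix w l l} ≤
      Real.exp (-(n * normalCDF (-t))) := by
    rw [hset, Measure.real, goeMeasure_forall_le_diag, Finset.card_univ, Fintype.card_fin]
    exact ENNReal.toReal_le_of_le_ofReal (Real.exp_pos _).le (gaussianReal_Ici_pow_le _ n)
  have htle : t ≤ √18 * (n : ℝ) ^ (1 / 20 : ℝ) := by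
    have h := Real.log_le_rpow_div hn0.le (by norm_num : (0 : ℝ) < 1 / 10)
    have h20 : (n : ℝ) ^ (1 / 10 : ℝ) = ((n : ℝ) ^ (1 / 20 : ℝ)) ^ 2 := by
      rw [← Real.rpow_natCast, ← Real.rpow_mul hn0.le]
      norm_num
    rw [ht]
    refine Real.sqrt_le_iff.2 ⟨by positivity, ?_⟩
    rw [mul_pow, Real.sq_sqrt (by norm_num), ← h20]
    linarith
  have hpdf : gaussianPDFReal 0 1 (-t) = (√(2 * Real.pi))⁻¹ * (n : ℝ) ^ (-(9 / 10) : ℝ) := by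
    simp only [gaussianPDFReal, sub_zero, NNReal.coe_one, mul_one, neg_sq]
    rw [ht, Real.sq_sqrt (by positivity), Real.rpow_def_of_pos hn0]
    congr 2
    ring
  have hkey : b * (n : ℝ) ^ (1 / 20 : ℝ) ≤ n * normalCDF (-t) := by
    have h := gaussianPDFReal_le_mul_normalCDF ht1
    rw [hpdf] at h
    have hΦ := normalCDF_nonneg (-t)
    have h3 : (√(2 * Real.pi))⁻¹ * (n : ℝ) ^ (-(9 / 10) : ℝ) ≤
        Real.exp (3 / 2) * (√18 * (n : ℝ) ^ (1 / 20 : ℝ)) * normalCDF (-t) :=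
      h.trans (by gcongr)
    have hee : Real.exp (-(3 / 2)) * Real.exp (3 / 2) = 1 := by
      rw [← Real.exp_add]
      simp
    have hnn : (n : ℝ) ^ (1 / 20 : ℝ) * (n : ℝ) ^ (1 / 20 : ℝ) = n * (n : ℝ) ^ (-(9 / 10) : ℝ) := by
      rw [← Real.rpow_add hn0, ← Real.rpow_one_add' hn0.le (by norm_num)]
      norm_num
    have hx : 0 < (n : ℝ) ^ (1 / 20 : ℝ) := by positivity
    refine le_of_mul_le_mul_right ?_ hx
    calc b * (n : ℝ) ^ (1 / 20 : ℝ) * (n : ℝ) ^ (1 / 20 : ℝ)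
        = Real.exp (-(3 / 2)) / √18 * n *
          ((√(2 * Real.pi))⁻¹ * (n : ℝ) ^ (-(9 / 10) : ℝ)) := by
          rw [mul_assoc, hnn, hb]
          ring
      _ ≤ Real.exp (-(3 / 2)) / √18 * n *
          (Real.exp (3 / 2) * (√18 * (n : ℝ) ^ (1 / 20 : ℝ)) * normalCDF (-t)) :=
          mul_le_mul_of_nonneg_left h3 (by positivity)
      _ = (Real.exp (-(3 / 2)) * Real.exp (3 / 2)) * (n * normalCDF (-t) *
          (n : ℝ) ^ (1 / 20 : ℝ)) := by
          field_simp
      _ = _ := by rw [hee, one_mul]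
  have hbd : ((n : ℝ) ^ (1 / 20 : ℝ)) ^ (30 : ℝ) * Real.exp (-b * (n : ℝ) ^ (1 / 20 : ℝ)) ≤
      max C 1 := (hC (Set.mem_range_self n)).trans (le_max_left _ _)
  rw [← Real.rpow_mul hn0.le, show (1 / 20 * 30 : ℝ) = 3 / 2 by norm_num] at hbd
  refine h1.trans ((Real.exp_le_exp.2 (neg_le_neg hkey)).trans ?_)
  rw [Real.rpow_neg hn0.le, ← div_eq_mul_inv, le_div_iff₀ (by positivity), mul_comm, ← neg_mul]
  exact hbd

/-! ### Union bounds over supports -/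

theorem alpha_eq (k : ℕ) : alpha k = 2 * (k : ℝ) ^ 2 / ((k : ℝ) + 1) := by
  rw [alpha, sigmaSq, inv_div]

theorem alpha_eq' (k : ℕ) : alpha k = 2 * (k : ℝ) - 2 + 2 / ((k : ℝ) + 1) := by
  rw [alpha_eq]
  field_simp
  ring

theorem one_lt_alpha {k : ℕ} (hk : 2 ≤ k) : 1 < alpha k := by
  have h : (2 : ℝ) ≤ k := by exact_mod_cast hk
  rw [alpha_eq']
  have : 0 < 2 / ((k : ℝ) + 1) := by positivity
  linarith

/-- The number of pairs `(S, j)` is `k * n.choose k ≤ n ^ k`, because `k ≤ k!`. -/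
theorem measureReal_biUnion_powersetCard_le {n : ℕ} (k : ℕ)
    (A : Finset (Fin n) → Fin n → Set (UpperIndex n → ℝ)) {B : ℝ} (hB0 : 0 ≤ B)
    (hB : ∀ S : Finset (Fin n), S.card = k → ∀ j ∈ S, (goeMeasure n).real (A S j) ≤ B) :
    (goeMeasure n).real (⋃ S ∈ Finset.powersetCard k Finset.univ, ⋃ j ∈ S, A S j) ≤
      (n : ℝ) ^ k * B := by
  calc _ ≤ ∑ S ∈ Finset.powersetCard k (Finset.univ : Finset (Fin n)),
        (goeMeasure n).real (⋃ j ∈ S, A S j) := measureReal_biUnion_finset_le _ _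
    _ ≤ ∑ S ∈ Finset.powersetCard k (Finset.univ : Finset (Fin n)), k * B := by
        refine Finset.sum_le_sum fun S hS => ?_
        have hcard := (Finset.mem_powersetCard.1 hS).2
        refine (measureReal_biUnion_finset_le _ _).trans ?_
        refine (Finset.sum_le_sum fun j hj => hB S hcard j hj).trans ?_
        rw [Finset.sum_const, hcard, nsmul_eq_mul]
    _ = (n.choose k * k) * B := by
        rw [Finset.sum_const, Finset.card_powersetCard, Finset.card_univ, Fintype.card_fin,
          nsmul_eq_mul, mul_assoc]
    _ ≤ _ := by
        refine mul_le_mul_of_nonneg_right ?_ hB0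
        have h1 : (n.choose k : ℝ) ≤ (n : ℝ) ^ k / k.factorial := Nat.choose_le_pow_div k n
        have h2 : (k : ℝ) ≤ k.factorial := by exact_mod_cast Nat.self_le_factorial k
        have h3 : (0 : ℝ) < k.factorial := by exact_mod_cast k.factorial_pos
        rw [le_div_iff₀ h3] at h1
        exact (mul_le_mul_of_nonneg_left h2 (Nat.cast_nonneg _)).trans h1

theorem probKappaEq_eq_zero {n k : ℕ} (h : n < k) : probKappaEq n k = 0 := by
  have : {w : UpperIndex n → ℝ | kappa (goeMatrix w) = k} = ∅ := by
    ext w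
    have := kappa_le w
    simp
    omega
  rw [probKappaEq, this, measureReal_empty]

theorem probKappaGe_eq_zero {n k : ℕ} (h : n < k) : probKappaGe n k = 0 := by
  have : {w : UpperIndex n → ℝ | k ≤ kappa (goeMatrix w)} = ∅ := by
    ext w
    have := kappa_le w
    simp
    omega
  rw [probKappaGe, this, measureReal_empty]

theorem exists_probKappaEq_le {k : ℕ} (hk : 3 ≤ k) :
    ∃ C : ℝ, 0 < C ∧ ∀ n : ℕ, 1 ≤ n →
      probKappaEq n k ≤
        C * (n : ℝ) ^ ((2 : ℝ) - (k : ℝ) - 2 / ((k : ℝ) + 1)) *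
          (Real.log n) ^ ((k : ℝ) - 3 / 2 + 1 / ((k : ℝ) + 1)) := by
  obtain ⟨C, hC0, hC⟩ := exists_lintegral_gaussianReal_Ici_pow_le (one_lt_alpha (by omega : 2 ≤ k))
  refine ⟨C, hC0, fun n hn => ?_⟩
  have hlog0 : 0 ≤ Real.log n := Real.log_natCast_nonneg n
  -- Supports cannot exceed `n`; this also disposes of `n = 1`, where the logarithm vanishes.
  rcases lt_or_ge n k with hnk | hnk
  · rw [probKappaEq_eq_zero hnk]
    positivity
  have hn0 : (0 : ℝ) < n := by positivity
  set B := C * (n : ℝ) ^ (-alpha k) * Real.log n ^ ((alpha k - 1) / 2) with hB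
  have hB0 : 0 ≤ B := by positivity
  have hle := measureReal_biUnion_powersetCard_le k
    (fun S j => {w : UpperIndex n → ℝ | ∀ l, columnMean S j w ≤ goeMatrix w l l}) hB0
    fun S hS j hj => by
      refine ENNReal.toReal_le_of_le_ofReal hB0 ((goeMeasure_columnMean_le_diag hj).trans ?_)
      have h := hC n (by omega)
      rw [← hB] at h
      rwa [alpha, inv_inv, ← hS] at h
  have hsub : {w : UpperIndex n → ℝ | kappa (goeMatrix w) = k} ⊆
      ⋃ S ∈ Finset.powersetCard k Finset.univ, ⋃ j ∈ S,
        {w : UpperIndex n → ℝ | ∀ l, columnMean S j w ≤ goeMatrix w l l} := by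
    intro w hw
    obtain ⟨S, hS, j, hj, h⟩ := exists_columnMean_le_of_kappa (w := w) (by
      rw [show kappa (goeMatrix w) = k from hw]; omega)
    simp only [Set.mem_iUnion, Finset.mem_powersetCard]
    exact ⟨S, ⟨Finset.subset_univ S, hS.trans hw⟩, j, hj, h⟩
  refine (measureReal_mono hsub (measure_ne_top _ _)).trans (hle.trans (le_of_eq ?_))
  rw [hB, ← Real.rpow_natCast (n : ℝ) k]
  have h1 : (2 : ℝ) - (k : ℝ) - 2 / ((k : ℝ) + 1) = k + -alpha k := by
    rw [alpha_eq']
    ring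
  have h2 : (k : ℝ) - 3 / 2 + 1 / ((k : ℝ) + 1) = (alpha k - 1) / 2 := by
    rw [alpha_eq']
    ring
  rw [h1, h2, Real.rpow_add hn0]
  ring

/-- Supports of size at least four contribute at most order `n ^ (-3/2)`. -/
theorem exists_probKappaGe_four_le :
    ∃ C : ℝ, 0 < C ∧ ∀ n : ℕ, 2 ≤ n → probKappaGe n 4 ≤ C * (n : ℝ) ^ (-(3 / 2) : ℝ) := by
  obtain ⟨C, hC0, hC⟩ := exists_goeMeasure_diag_le
  refine ⟨C + 2, by positivity, fun n hn => ?_⟩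
  have hn0 : (0 : ℝ) < n := by positivity
  have hn1 : (1 : ℝ) ≤ n := by exact_mod_cast (by omega : 1 ≤ n)
  have hlog0 : 0 ≤ Real.log n := Real.log_natCast_nonneg n
  set t := √(9 / 5 * Real.log n) with ht
  set D : Set (UpperIndex n → ℝ) := {w | ∀ l, -t ≤ goeMatrix w l l} with hD
  set A : ℕ → Set (UpperIndex n → ℝ) := fun k =>
    ⋃ S ∈ Finset.powersetCard k Finset.univ, ⋃ j ∈ S,
      columnMean S j ⁻¹' Set.Iic (-t) with hA
  -- Union and Chernoff bounds give `n ^ (k - 9/10 α_k)`. The exponent is `-1.76` at `k = 4` and at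
  -- most `-5/2`, with equality at `k = 5`, afterwards; the latter absorbs a sum of up to `n` terms.
  have hAle : ∀ k ∈ Finset.Icc 4 n, (goeMeasure n).real (A k) ≤
      if k = 4 then (n : ℝ) ^ (-(3 / 2) : ℝ) else (n : ℝ) ^ (-(5 / 2) : ℝ) := by
    intro k hk
    have hk4 : 4 ≤ k := (Finset.mem_Icc.1 hk).1
    have h := measureReal_biUnion_powersetCard_le (n := n) k
      (fun S j => columnMean S j ⁻¹' Set.Iic (-t))
      (B := (n : ℝ) ^ (-(9 / 10 * alpha k))) (by positivity) fun S hS j hj => by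
        rw [← map_measureReal_apply (measurable_columnMean S j) measurableSet_Iic,
          map_columnMean hj, hS]
        refine (gaussianReal_Iic_neg_le _ (Real.sqrt_nonneg _)).trans (le_of_eq ?_)
        rw [Real.coe_toNNReal _ (sigmaSq_nonneg k), Real.sq_sqrt (by positivity),
          Real.rpow_def_of_pos hn0, alpha]
        congr 1
        ring
    refine h.trans ?_
    rw [← Real.rpow_natCast, ← Real.rpow_add hn0, alpha_eq]
    split_ifs with h4
    · subst h4
      refine Real.rpow_le_rpow_of_exponent_le hn1 ?_
      norm_num
    · refine Real.rpow_le_rpow_of_exponent_le hn1 ?_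
      have hk5 : (5 : ℝ) ≤ k := by exact_mod_cast (by omega : 5 ≤ k)
      have : (k : ℝ) + 5 / 2 ≤ 9 / 10 * (2 * (k : ℝ) ^ 2 / (k + 1)) := by
        rw [← mul_div_assoc, le_div_iff₀ (by positivity)]
        nlinarith
      linarith
  have hsum : ∑ k ∈ Finset.Icc 4 n, (goeMeasure n).real (A k) ≤ 2 * (n : ℝ) ^ (-(3 / 2) : ℝ) := by
    calc _ ≤ ∑ k ∈ Finset.Icc 4 n, ((if k = 4 then (n : ℝ) ^ (-(3 / 2) : ℝ) else 0) +
          (n : ℝ) ^ (-(5 / 2) : ℝ)) := by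
          refine Finset.sum_le_sum fun k hk => (hAle k hk).trans ?_
          have : 0 ≤ (n : ℝ) ^ (-(5 / 2) : ℝ) := by positivity
          split_ifs <;> linarith
      _ ≤ (n : ℝ) ^ (-(3 / 2) : ℝ) + n * (n : ℝ) ^ (-(5 / 2) : ℝ) := by
          rw [Finset.sum_add_distrib, Finset.sum_ite_eq', Finset.sum_const, nsmul_eq_mul]
          refine add_le_add ?_ (mul_le_mul_of_nonneg_right ?_ (by positivity))
          · split_ifs
            · exact le_rfl
            · positivity
          · rw [Nat.card_Icc]
            exact_mod_cast (by omega : n + 1 - 4 ≤ n)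
      _ = _ := by
          rw [← Real.rpow_one_add' hn0.le (by norm_num), two_mul]
          norm_num
  have hsub : {w : UpperIndex n → ℝ | 4 ≤ kappa (goeMatrix w)} ⊆
      D ∪ ⋃ k ∈ Finset.Icc 4 n, A k := by
    intro w hw
    by_cases hwD : w ∈ D
    · exact Or.inl hwD
    refine Or.inr ?_
    have hw4 : 4 ≤ kappa (goeMatrix w) := hw
    obtain ⟨S, hS, j, hj, h⟩ := exists_columnMean_le_of_kappa (w := w) (by omega)
    simp only [hD, Set.mem_ofPred_eq, not_forall, not_le] at hwD
    obtain ⟨l, hl⟩ := hwD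
    simp only [hA, Set.mem_iUnion, Finset.mem_powersetCard, Finset.mem_Icc]
    exact ⟨_, ⟨hw4, kappa_le w⟩, S, ⟨Finset.subset_univ S, hS⟩, j, hj, (h l).trans hl.le⟩
  calc probKappaGe n 4 ≤ (goeMeasure n).real (D ∪ ⋃ k ∈ Finset.Icc 4 n, A k) :=
        measureReal_mono hsub
    _ ≤ (goeMeasure n).real D + ∑ k ∈ Finset.Icc 4 n, (goeMeasure n).real (A k) :=
        (measureReal_union_le _ _).trans (add_le_add le_rfl (measureReal_biUnion_finset_le _ _))
    _ ≤ C * (n : ℝ) ^ (-(3 / 2) : ℝ) + 2 * (n : ℝ) ^ (-(3 / 2) : ℝ) := add_le_add (hC n hn) hsum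
    _ = _ := by ring

/-! ### Support size at least three, and asymptotics -/

theorem exists_probKappa_three_le :
    ∃ C : ℝ, 0 < C ∧ ∀ n : ℕ, 1 ≤ n →
      probKappaEq n 3 ≤ C * ((Real.log n) ^ (7 / 4 : ℝ) / (n : ℝ) ^ (3 / 2 : ℝ)) ∧
      probKappaGe n 3 ≤ C * ((Real.log n) ^ (7 / 4 : ℝ) / (n : ℝ) ^ (3 / 2 : ℝ)) := by
  obtain ⟨C₃, hC₃, h3⟩ := exists_probKappaEq_le (le_refl 3)
  obtain ⟨C₄, hC₄, h4⟩ := exists_probKappaGe_four_le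
  have hlog2 : 0 < Real.log 2 := Real.log_pos (by norm_num)
  set L := Real.log 2 ^ (7 / 4 : ℝ) with hL
  have hL0 : 0 < L := by positivity
  have h3' : ∀ n : ℕ, 1 ≤ n →
      probKappaEq n 3 ≤ C₃ * ((Real.log n) ^ (7 / 4 : ℝ) / (n : ℝ) ^ (3 / 2 : ℝ)) := by
    intro n hn
    refine (h3 n hn).trans (le_of_eq ?_)
    rw [div_eq_mul_inv (_ ^ (7 / 4 : ℝ)), ← Real.rpow_neg (Nat.cast_nonneg n)]
    norm_num
    ring
  refine ⟨C₃ + C₄ / L, by positivity, fun n hn => ?_⟩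
  have hlog0 : 0 ≤ Real.log n := Real.log_natCast_nonneg n
  set g := (Real.log n) ^ (7 / 4 : ℝ) / (n : ℝ) ^ (3 / 2 : ℝ) with hg
  have hg0 : 0 ≤ g := by positivity
  refine ⟨(h3' n hn).trans (mul_le_mul_of_nonneg_right ?_ hg0), ?_⟩
  · have : 0 < C₄ / L := by positivity
    linarith
  rcases lt_or_ge n 2 with hn2 | hn2
  · rw [probKappaGe_eq_zero (by omega)]
    positivity
  have hsub : {w : UpperIndex n → ℝ | 3 ≤ kappa (goeMatrix w)} ⊆
      {w | kappa (goeMatrix w) = 3} ∪ {w | 4 ≤ kappa (goeMatrix w)} := by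
    intro w hw
    have hw3 : 3 ≤ kappa (goeMatrix w) := hw
    exact hw3.eq_or_lt.imp Eq.symm id
  have hlog : L ≤ Real.log n ^ (7 / 4 : ℝ) :=
    Real.rpow_le_rpow hlog2.le
      (Real.log_le_log (by norm_num) (by exact_mod_cast hn2)) (by norm_num)
  calc probKappaGe n 3 ≤ probKappaEq n 3 + probKappaGe n 4 :=
        (measureReal_mono hsub).trans (measureReal_union_le _ _)
    _ ≤ C₃ * g + C₄ * (n : ℝ) ^ (-(3 / 2) : ℝ) := add_le_add (h3' n hn) (h4 n hn2)
    _ ≤ C₃ * g + C₄ / L * g := by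
        refine add_le_add le_rfl ?_
        rw [hg, Real.rpow_neg (Nat.cast_nonneg n), ← one_div, div_mul_div_comm, mul_one_div,
          div_le_div_iff₀ (by positivity) (by positivity)]
        have : 0 ≤ C₄ * (n : ℝ) ^ (3 / 2 : ℝ) := by positivity
        nlinarith [mul_le_mul_of_nonneg_left hlog this]
    _ = _ := by ring

theorem isLittleO_log_rpow_div_rpow :
    (fun n : ℕ => (Real.log n) ^ (7 / 4 : ℝ) / (n : ℝ) ^ (3 / 2 : ℝ)) =o[atTop]
      fun n : ℕ => 1 / ((n : ℝ) * (Real.log n) ^ (3 / 2 : ℝ)) := by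
  -- After clearing the common factor the claim is `(log x)^(13/4) = o(x^(1/2))`, with `13/4 = 7/4 +
  -- 3/2`.
  have h := ((isLittleO_log_rpow_rpow_atTop (13 / 4) (by norm_num : (0 : ℝ) < 1 / 2)).mul_isBigO
    (isBigO_refl (fun x : ℝ => (x ^ (3 / 2 : ℝ) * Real.log x ^ (3 / 2 : ℝ))⁻¹) atTop)).comp_tendsto
      tendsto_natCast_atTop_atTop
  refine h.congr' ?_ ?_
  all_goals
    filter_upwards [eventually_ge_atTop 2] with n hn
    have hn0 : (0 : ℝ) < n := by positivity
    have hlog0 : 0 < Real.log n := Real.log_pos (by exact_mod_cast hn)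
    simp only [Function.comp]
  · rw [show (13 / 4 : ℝ) = 7 / 4 + 3 / 2 by norm_num, Real.rpow_add hlog0]
    field_simp
  · rw [show (3 / 2 : ℝ) = 1 / 2 + 1 by norm_num, Real.rpow_add hn0, Real.rpow_one]
    field_simp

theorem mainTheorem2 :
    -- almost sure uniqueness of the global optimizer, so that `κ_n` is well defined
    (∀ n : ℕ, 1 ≤ n → ∀ᵐ w ∂(goeMeasure n), ∃! x, IsGlobalOptimizer (goeMatrix w) x) ∧
    -- bound for each fixed support size
    (∀ k : ℕ, 3 ≤ k →
      (alpha k = 2 * (k : ℝ) ^ 2 / ((k : ℝ) + 1) ∧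
        alpha k = 2 * (k : ℝ) - 2 + 2 / ((k : ℝ) + 1)) ∧
      ∃ C : ℝ, ∀ n : ℕ, 1 ≤ n →
        probKappaEq n k ≤
          C * (n : ℝ) ^ ((2 : ℝ) - (k : ℝ) - 2 / ((k : ℝ) + 1)) *
            (Real.log n) ^ ((k : ℝ) - 3 / 2 + 1 / ((k : ℝ) + 1))) ∧
    -- support size three, and support size at least three
    (∃ C : ℝ, 0 < C ∧ ∀ n : ℕ, 1 ≤ n →
      probKappaEq n 3 ≤ C * ((Real.log n) ^ (7 / 4 : ℝ) / (n : ℝ) ^ (3 / 2 : ℝ)) ∧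
      probKappaGe n 3 ≤ C * ((Real.log n) ^ (7 / 4 : ℝ) / (n : ℝ) ^ (3 / 2 : ℝ))) ∧
    ((fun n : ℕ => (Real.log n) ^ (7 / 4 : ℝ) / (n : ℝ) ^ (3 / 2 : ℝ)) =o[atTop]
      fun n : ℕ => 1 / ((n : ℝ) * (Real.log n) ^ (3 / 2 : ℝ))) ∧
    ((fun n : ℕ => probKappaGe n 3) =o[atTop]
      fun n : ℕ => 1 / ((n : ℝ) * (Real.log n) ^ (3 / 2 : ℝ))) := by

  refine ⟨fun n hn => ae_existsUnique_isGlobalOptimizer hn, fun k hk => ?_,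
    exists_probKappa_three_le, isLittleO_log_rpow_div_rpow, ?_⟩
  · obtain ⟨C, -, hC⟩ := exists_probKappaEq_le hk
    exact ⟨⟨alpha_eq k, alpha_eq' k⟩, C, hC⟩
  · obtain ⟨C, -, hC⟩ := exists_probKappa_three_le
    refine IsBigO.trans_isLittleO (IsBigO.of_bound C ?_) isLittleO_log_rpow_div_rpow
    filter_upwards [eventually_ge_atTop 1] with n hn
    have hlog0 : 0 ≤ Real.log n := Real.log_natCast_nonneg n
    rw [Real.norm_of_nonneg (show 0 ≤ probKappaGe n 3 from measureReal_nonneg),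
      Real.norm_of_nonneg (by positivity)]
    exact (hC n hn).2
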